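/- Let $d\in\mathbb N$ and let $V=(\mathbb C^d)^{d+1}$, with elements $(p_1,\dots,p_{d+1})$, $p_i=(p_i^1,\dots,p_i^d)\in\mathbb C^d$. Let $p_i\cdot p_j=\sum_{k=1}^d p_i^kp_j^k\in\mathbb C[V]$, and let $O(d)=\{A\in\mathbb C^{d\times d}: AA^{T}=1\}$ act on $V$ by $(p_1,\dots,p_{d+1})\mapsto(Ap_1,\dots,Ap_{d+1})$, with algebra of invariant polynomials $\mathbb C[V]^{O(d)}$. Consider the polynomials $$\theta_i=p_1\cdot p_1+p_i\cdot p_i\quad(2\le i\le d+1),\qquad \alpha_{ij}=p_i\cdot p_j\quad(1\le i<j\le d+1).$$ 1. These are $d(d+3)/2$ polynomials, and they form a homogeneous system of parameters of $\mathbb C[V]^{O(d)}$: they are homogeneous invariants of positive degree, they are algebraically independent over $\mathbb C$, and $\mathbb C[V]^{O(d)}$ is a finitely generated module over the subalgebra $\mathbb C[\theta_i,\alpha_{ij}]$. 2. Their common zero set in $V$ is the nullcone of $\mathbb C[V]^{O(d)}$, i.e. the set of common zeros of all homogeneous invariants of strictly positive degree; this is the set of points where $p_i\cdot p_j=0$ for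 all $i,j$. 3. The Gram determinant $\det(p_i\cdot p_j)_{1\le i,j\le d+1}$ is the zero polynomial. At the point $p_1=0$, $p_{i}=e_{i-1}$ $(2\le i\le d+1)$, where $e_1,\dots,e_d$ is the standard basis of $\mathbb C^d$, the Jacobian minor of $(\theta_i,\alpha_{ij})$ with respect to the $d(d+3)/2$ coordinates $p_1^k$ $(1\le k\le d)$ and $p_i^k$ $(2\le i\le d+1,\ i-1\le k\le d)$, in a suitable order, equals $2^d$. -/

import Mathlib

open MvPolynomial

/-- The polynomial algebra `ℂ[V]` on `V = (ℂ^d)^n`; the variable `X (i, k)` is the `k`-th component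
of the momentum `p_i`. -/
abbrev MomentumPoly (n d : ℕ) : Type := MvPolynomial (Fin n × Fin d) ℂ

/-- The dot product `p_i · p_j` (bilinear, no complex conjugation), as an element of `ℂ[V]`. -/
noncomputable def dotPoly {n d : ℕ} (i j : Fin n) : MomentumPoly n d :=
  ∑ k : Fin d, X (i, k) * X (j, k)

/-- The substitution `p_i ↦ A p_i` (simultaneously for all `i`) in polynomials on `V`, that is
`f ↦ (v ↦ f (A v))`. -/
noncomputable def momentumSubst {n d : ℕ} (A : Matrix (Fin d) (Fin d) ℂ) :
    MomentumPoly n d →ₐ[ℂ] MomentumPoly n d :=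
  aeval fun x : Fin n × Fin d => ∑ l : Fin d, C (A x.2 l) * X (x.1, l)

/-- The algebra `ℂ[V]^{O(d)}` of polynomials invariant under the complex orthogonal group
`O(d, ℂ) = {A | A Aᵀ = 1}` acting diagonally on the `n` momenta. -/
noncomputable def orthogonalInvariants (n d : ℕ) : Subalgebra ℂ (MomentumPoly n d) where
  carrier := {f | ∀ A ∈ Matrix.orthogonalGroup (Fin d) ℂ, momentumSubst A f = f}
  mul_mem' hf hg A hA := by rw [map_mul, hf A hA, hg A hA]
  add_mem' hf hg A hA := by rw [map_add, hf A hA, hg A hA]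
  algebraMap_mem' r A _ := (momentumSubst A).commutes r

/-- A family `f` of polynomials is a homogeneous system of parameters of the graded subalgebra `S`
of `ℂ[x]`: its members are homogeneous elements of `S` of positive degree, algebraically independent
over `ℂ`, and `S` is a finitely generated module over the subalgebra that they generate. -/
structure IsHSOP {σ ι : Type} (S : Subalgebra ℂ (MvPolynomial σ ℂ)) (f : ι → MvPolynomial σ ℂ) :
    Prop where
  mem : ∀ i, f i ∈ S
  homogeneous : ∀ i, ∃ m : ℕ, 0 < m ∧ (f i).IsHomogeneous m
  algebraicIndependent : AlgebraicIndependent ℂ f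
  finite : Module.Finite (Algebra.adjoin ℂ (Set.range fun i => (⟨f i, mem i⟩ : S))) S

/-- The nullcone of a graded subalgebra `S` of `ℂ[x]`: the common zeros of all homogeneous elements
of `S` of strictly positive degree. -/
def nullcone {σ : Type} (S : Subalgebra ℂ (MvPolynomial σ ℂ)) : Set (σ → ℂ) :=
  {v | ∀ f ∈ S, ∀ m : ℕ, 0 < m → f.IsHomogeneous m → eval v f = 0}

/-- Labels of the proposed parameters: `i : Fin d` labels the `θ`'s, and the pairs `i < j` label
the `α`'s. -/
abbrev ParamIndex (d : ℕ) : Type := Fin d ⊕ {x : Fin (d + 1) × Fin (d + 1) // x.1 < x.2}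

/-- The polynomials `p_0 · p_0 + p_i · p_i` (`i ≠ 0`) and `p_i · p_j` (`i < j`) in `d + 1` momenta,
which are numbered `0, …, d` here. -/
noncomputable def params (d : ℕ) : ParamIndex d → MomentumPoly (d + 1) d
  | Sum.inl i => dotPoly 0 0 + dotPoly i.succ i.succ
  | Sum.inr x => dotPoly x.1.1 x.1.2

/-- The point of `V` with `p_0 = 0` and with `p_{k+1}` the `k`-th standard basis vector. -/
def basePoint (d : ℕ) : Fin (d + 1) × Fin d → ℂ :=
  fun x => if x.1 = x.2.succ then 1 else 0

/-- The coordinates selected for the Jacobian minor: all components of `p_0`, and the components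
`k, …, d - 1` of `p_{k+1}`. -/
abbrev MinorCoord (d : ℕ) : Type := {x : Fin (d + 1) × Fin d // x.1 ≤ x.2.succ}

/-! Nullcone: if all `p_i · p_j` vanish, the `p_i` span a totally isotropic space, on which some
orthogonal matrix acts as multiplication by 2 (`exists_orthogonal_mulVec_eq_two_smul`). An invariant
`f` of degree `m > 0` then satisfies `f(v) = f(2v) = 2^m f(v)`, so `f(v) = 0`. Where the parameters
vanish, the Gram matrix is diagonal and singular (`d + 1` vectors in dimension `d`); hence one `p_i
· p_i` is zero, and the `θ`'s make the others zero.

Finiteness is Hilbert's argument: by the Nullstellensatz, invariants of large degree lie in the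
ideal of the parameters, and they can be rewritten with invariant coefficients of lower degree.
Instead of averaging over a compact group, the proof projects orthogonally for a Hermitian form on
polynomials under which substitution of `M` has adjoint substitution of `M*` (`fischer_linSubst`);
it suffices that the group is closed under conjugate transpose.

Algebraic independence follows from the Jacobian criterion, as the chosen minor is diagonal at the
base point. -/

/-- The substitution `f ↦ (v ↦ f (M v))` in polynomials on `σ → ℂ`. -/
noncomputable def linSubst {σ : Type} [Fintype σ] (M : Matrix σ σ ℂ) :
    MvPolynomial σ ℂ →ₐ[ℂ] MvPolynomial σ ℂ :=
  aeval fun i => ∑ j, C (M i j) * X j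

theorem eval_linSubst {σ : Type} [Fintype σ] (M : Matrix σ σ ℂ) (f : MvPolynomial σ ℂ)
    (w : σ → ℂ) : eval w (linSubst M f) = eval (M.mulVec w) f := by
  have h : (aeval w).comp (linSubst M) = aeval (M.mulVec w) (S₁ := ℂ) := by
    ext i
    simp [linSubst, Matrix.mulVec, dotProduct]
  simpa [coe_aeval_eq_eval] using DFunLike.congr_fun h f

theorem MvPolynomial.IsHomogeneous.linSubst {σ : Type} [Fintype σ] (M : Matrix σ σ ℂ)
    {f : MvPolynomial σ ℂ} {m : ℕ} (hf : f.IsHomogeneous m) :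
    (linSubst M f).IsHomogeneous m := by
  have h := hf.aeval (fun i => ∑ j, C (M i j) * X j) (n := 1)
    (fun i => IsHomogeneous.sum _ _ _ fun j _ => isHomogeneous_C_mul_X _ _)
  rwa [one_mul] at h

/-! ### The Fischer form, its reproducing kernel and adjoints -/

/-- The Hermitian form on polynomials in which the monomials are orthogonal, the square of the
length of a monomial being the inverse of its multinomial coefficient. In each degree this is the
Fischer form up to a constant. -/
noncomputable def fischer {σ : Type} (f g : MvPolynomial σ ℂ) : ℂ :=
  ∑ a ∈ g.support, star (coeff a f) * coeff a g / (a.multinomial : ℂ)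

section Fischer

variable {σ : Type}

theorem fischer_eq_sum {s : Finset (σ →₀ ℕ)} (f : MvPolynomial σ ℂ) {g : MvPolynomial σ ℂ}
    (hs : g.support ⊆ s) :
    fischer f g = ∑ a ∈ s, star (coeff a f) * coeff a g / (a.multinomial : ℂ) :=
  Finset.sum_subset hs fun a _ ha => by simp [notMem_support_iff.mp ha]

theorem fischer_add_left (f g h : MvPolynomial σ ℂ) :
    fischer (f + g) h = fischer f h + fischer g h := by
  simp [fischer, add_mul, add_div, Finset.sum_add_distrib]

theorem fischer_smul_left (c : ℂ) (f h : MvPolynomial σ ℂ) :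
    fischer (c • f) h = star c * fischer f h := by
  simp [fischer, Finset.mul_sum, mul_assoc, mul_div_assoc]

theorem star_fischer (f g : MvPolynomial σ ℂ) : star (fischer g f) = fischer f g := by
  classical
  rw [fischer_eq_sum g (Finset.subset_union_left : _ ⊆ f.support ∪ g.support),
    fischer_eq_sum f (Finset.subset_union_right : _ ⊆ f.support ∪ g.support)]
  simp [mul_comm]

theorem fischer_self (f : MvPolynomial σ ℂ) :
    fischer f f = ((∑ a ∈ f.support, ‖coeff a f‖ ^ 2 / (a.multinomial : ℝ) : ℝ) : ℂ) := by
  simp only [fischer, Complex.ofReal_sum]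
  refine Finset.sum_congr rfl fun a _ => ?_
  push_cast
  rw [← Complex.conj_mul', starRingEnd_apply]

theorem fischer_self_eq_zero {f : MvPolynomial σ ℂ} (h : fischer f f = 0) : f = 0 := by
  rw [fischer_self, Complex.ofReal_eq_zero,
    Finset.sum_eq_zero_iff_of_nonneg fun a _ => by positivity] at h
  by_contra hf
  obtain ⟨a, ha⟩ := support_nonempty.mpr hf
  have h1 : (a.multinomial : ℝ) ≠ 0 := by
    rw [Finsupp.multinomial_eq]
    exact_mod_cast (Nat.multinomial_pos _ _).ne'
  have h2 := h a ha
  rw [div_eq_zero_iff, or_iff_left h1] at h2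
  exact mem_support_iff.mp ha (by simpa using h2)

/-- The form `fischer` as an inner product. -/
@[reducible]
noncomputable def fischerCore (σ : Type) : InnerProductSpace.Core ℂ (MvPolynomial σ ℂ) where
  inner := fischer
  conj_inner_symm f g := star_fischer f g
  re_inner_nonneg f := by
    rw [fischer_self, RCLike.re_eq_complex_re, Complex.ofReal_re]
    refine Finset.sum_nonneg fun a _ => by positivity
  add_left := fischer_add_left
  smul_left f g c := fischer_smul_left c f g
  definite _ := fischer_self_eq_zero

theorem exists_add_fischer_orthogonal [Finite σ] {m : ℕ} {W : Submodule ℂ (MvPolynomial σ ℂ)}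
    (hW : W ≤ homogeneousSubmodule σ ℂ m) {f : MvPolynomial σ ℂ} (hf : f.IsHomogeneous m) :
    ∃ w ∈ W, ∃ r : MvPolynomial σ ℂ, r.IsHomogeneous m ∧ (∀ u ∈ W, fischer u r = 0) ∧
      f = w + r := by
  let _ : NormedAddCommGroup (MvPolynomial σ ℂ) := (fischerCore σ).toNormedAddCommGroup
  let _ : InnerProductSpace ℂ (MvPolynomial σ ℂ) := InnerProductSpace.ofCore (fischerCore σ).toCore
  have : Module.Finite ℂ (homogeneousSubmodule σ ℂ m) :=
    Module.Finite.iff_fg.mpr (homogeneousSubmodule_fg σ ℂ m)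
  have : FiniteDimensional ℂ W := Submodule.finiteDimensional_of_le hW
  obtain ⟨w, hw, r, hr, rfl⟩ := W.exists_add_mem_mem_orthogonal f
  refine ⟨w, hw, r, ?_, fun u hu => (Submodule.mem_orthogonal W r).mp hr u hu, rfl⟩
  simpa using hf.sub (hW hw)

/-- The reproducing kernel of the form `fischer` in degree `m`. -/
noncomputable def fischerKernel [Fintype σ] (m : ℕ) (w : σ → ℂ) : MvPolynomial σ ℂ :=
  (∑ j, C (star (w j)) * X j) ^ m

theorem isHomogeneous_fischerKernel [Fintype σ] (m : ℕ) (w : σ → ℂ) :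
    (fischerKernel m w).IsHomogeneous m := by
  have h : (∑ j, C (star (w j)) * X j : MvPolynomial σ ℂ).IsHomogeneous 1 :=
    IsHomogeneous.sum _ _ _ fun j _ => isHomogeneous_C_mul_X _ _
  simpa [fischerKernel] using h.pow m

theorem coeff_fischerKernel [Fintype σ] (w : σ → ℂ) (a : σ →₀ ℕ) :
    coeff a (fischerKernel a.degree w) = a.multinomial * ∏ i, star (w i) ^ a i := by
  classical
  have h : (∑ j, C (star (w j)) * X j : MvPolynomial σ ℂ) =
      (Finsupp.equivFunOnFinite.symm fun j => star (w j)).linearCombination ℂ X := by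
    rw [Finsupp.linearCombination_apply, Finsupp.sum_fintype _ _ (by simp)]
    simp [smul_eq_C_mul]
  rw [fischerKernel, h, coeff_linearCombination_X_pow]
  simp [Finsupp.prod_fintype, Finsupp.degree_eq_sum, Finsupp.sum_fintype]

/-- The multinomial coefficients in the power of a linear form cancel the weights of `fischer`. -/
theorem fischer_fischerKernel [Fintype σ] {m : ℕ} (w : σ → ℂ) {f : MvPolynomial σ ℂ}
    (hf : f.IsHomogeneous m) : fischer (fischerKernel m w) f = eval w f := by
  rw [eval_eq', fischer]
  refine Finset.sum_congr rfl fun a ha => ?_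
  have hm : a.degree = m := by
    by_contra h
    exact mem_support_iff.mp ha (hf.coeff_eq_zero h)
  have h1 : (a.multinomial : ℂ) ≠ 0 := by
    rw [Finsupp.multinomial_eq]
    exact_mod_cast (Nat.multinomial_pos _ _).ne'
  subst hm
  rw [coeff_fischerKernel]
  simp only [star_mul', star_prod, star_pow, star_star, star_natCast]
  field_simp

theorem linSubst_fischerKernel [Fintype σ] (M : Matrix σ σ ℂ) (m : ℕ) (w : σ → ℂ) :
    linSubst M.conjTranspose (fischerKernel m w) = fischerKernel m (M.mulVec w) := by
  simp only [fischerKernel, map_pow]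
  congr 1
  simp only [linSubst, map_sum, map_mul, algHom_C, aeval_X, Finset.mul_sum, Matrix.mulVec,
    dotProduct, star_sum, star_mul', Finset.sum_mul, Matrix.conjTranspose_apply]
  rw [Finset.sum_comm]
  refine Finset.sum_congr rfl fun j _ => Finset.sum_congr rfl fun i _ => ?_
  simp only [algebraMap_eq]
  ring

theorem span_fischerKernel [Fintype σ] (m : ℕ) :
    Submodule.span ℂ (Set.range (fischerKernel m)) = homogeneousSubmodule σ ℂ m := by
  have hle : Submodule.span ℂ (Set.range (fischerKernel m)) ≤ homogeneousSubmodule σ ℂ m := by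
    rw [Submodule.span_le]
    rintro _ ⟨w, rfl⟩
    exact isHomogeneous_fischerKernel m w
  refine le_antisymm hle fun f hf => ?_
  obtain ⟨w, hw, r, hr, horth, rfl⟩ := exists_add_fischer_orthogonal hle hf
  -- Orthogonality to the kernel at `v` means vanishing at `v`.
  have : r = 0 := MvPolynomial.funext fun v => by
    rw [← fischer_fischerKernel v hr, horth _ (Submodule.subset_span ⟨v, rfl⟩), map_zero]
  simpa [this] using hw

/-- Kernels span each degree, and for the kernel at `w` both sides are the value of `g` at `M w`. -/
theorem fischer_linSubst [Fintype σ] (M : Matrix σ σ ℂ) {m : ℕ} {f g : MvPolynomial σ ℂ}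
    (hf : f.IsHomogeneous m) (hg : g.IsHomogeneous m) :
    fischer (linSubst M.conjTranspose f) g = fischer f (linSubst M g) := by
  have hf' : f ∈ Submodule.span ℂ (Set.range (fischerKernel m)) := by
    rw [span_fischerKernel]
    exact hf
  clear hf
  induction hf' using Submodule.span_induction with
  | mem x hx =>
    obtain ⟨w, rfl⟩ := hx
    rw [linSubst_fischerKernel, fischer_fischerKernel _ hg,
      fischer_fischerKernel _ (hg.linSubst M), eval_linSubst]
  | zero => simp [fischer]
  | add x y _ _ hx hy => rw [map_add, fischer_add_left, fischer_add_left, hx, hy]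
  | smul c x _ hx => rw [map_smul, fischer_smul_left, fischer_smul_left, hx]

theorem fischer_sub_left (f g h : MvPolynomial σ ℂ) :
    fischer (f - g) h = fischer f h - fischer g h := by
  simp [fischer, sub_mul, sub_div, Finset.sum_sub_distrib]

theorem fischer_sub_right (f g h : MvPolynomial σ ℂ) :
    fischer f (g - h) = fischer f g - fischer f h := by
  rw [← star_fischer, fischer_sub_left, star_sub, star_fischer, star_fischer]

end Fischer

/-! ### Invariants of an adjoint-closed set of matrices -/

/-- The polynomials invariant under substitution of the matrices in `G`. -/
noncomputable def linInvariants {σ : Type} [Fintype σ] (G : Set (Matrix σ σ ℂ)) :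
    Subalgebra ℂ (MvPolynomial σ ℂ) where
  carrier := {f | ∀ M ∈ G, linSubst M f = f}
  mul_mem' hf hg M hM := by rw [map_mul, hf M hM, hg M hM]
  add_mem' hf hg M hM := by rw [map_add, hf M hM, hg M hM]
  algebraMap_mem' r M _ := (linSubst M).commutes r

section Invariants

variable {σ : Type} [Fintype σ] {G : Set (Matrix σ σ ℂ)}

theorem homogeneousComponent_linSubst (M : Matrix σ σ ℂ) (m : ℕ) (f : MvPolynomial σ ℂ) :
    homogeneousComponent m (linSubst M f) = linSubst M (homogeneousComponent m f) := by
  conv_lhs => rw [← sum_homogeneousComponent f, map_sum, map_sum]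
  have h (i : ℕ) : homogeneousComponent m (linSubst M (homogeneousComponent i f)) =
      if i = m then linSubst M (homogeneousComponent i f) else 0 := by
    rw [homogeneousComponent_of_mem
      (((homogeneousComponent_isHomogeneous i f).linSubst M : _))]
    simp [eq_comm]
  simp only [h, Finset.sum_ite_eq', Finset.mem_range]
  split_ifs with hm
  · rfl
  · rw [homogeneousComponent_eq_zero _ _ (by omega), map_zero]

theorem homogeneousComponent_mem_linInvariants {f : MvPolynomial σ ℂ}
    (hf : f ∈ linInvariants G) (m : ℕ) : homogeneousComponent m f ∈ linInvariants G :=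
  fun M hM => by rw [← homogeneousComponent_linSubst, hf M hM]

/-- The span of the differences `M f - f` with `M ∈ G` and `f` homogeneous of degree `m`. -/
noncomputable def coinvariantKernel (G : Set (Matrix σ σ ℂ)) (m : ℕ) :
    Submodule ℂ (MvPolynomial σ ℂ) :=
  Submodule.span ℂ {f | ∃ M ∈ G, ∃ k : MvPolynomial σ ℂ, k.IsHomogeneous m ∧
    f = linSubst M k - k}

theorem coinvariantKernel_le (m : ℕ) : coinvariantKernel G m ≤ homogeneousSubmodule σ ℂ m := by
  rw [coinvariantKernel, Submodule.span_le]
  rintro _ ⟨M, -, k, hk, rfl⟩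
  exact (hk.linSubst M).sub hk

/-- `(M k - k) g = M (k g) - k g` for invariant `g`. This plays the role of linearity of a Reynolds
operator over the invariants. -/
theorem mul_mem_coinvariantKernel {f g : MvPolynomial σ ℂ} {m n : ℕ}
    (hf : f ∈ coinvariantKernel G m) (hg : g ∈ linInvariants G) (hn : g.IsHomogeneous n) :
    f * g ∈ coinvariantKernel G (m + n) := by
  induction hf using Submodule.span_induction with
  | mem x hx =>
    obtain ⟨M, hM, k, hk, rfl⟩ := hx
    refine Submodule.subset_span ⟨M, hM, k * g, hk.mul hn, ?_⟩
    rw [map_mul, hg M hM, sub_mul]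
  | zero => simp
  | add x y _ _ hx hy => rw [add_mul]; exact add_mem hx hy
  | smul c x _ hx => rw [smul_mul_assoc]; exact Submodule.smul_mem _ _ hx

/-- By adjointness an invariant is orthogonal to every `M k - k`, hence here to itself. -/
theorem eq_zero_of_mem_coinvariantKernel (hG : ∀ M ∈ G, M.conjTranspose ∈ G)
    {f : MvPolynomial σ ℂ} {m : ℕ} (hf : f ∈ coinvariantKernel G m) (hi : f ∈ linInvariants G) :
    f = 0 := by
  have hm : f.IsHomogeneous m := coinvariantKernel_le m hf
  have key : ∀ u ∈ coinvariantKernel G m, fischer u f = 0 := by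
    intro u hu
    induction hu using Submodule.span_induction with
    | mem x hx =>
      obtain ⟨M, hM, k, hk, rfl⟩ := hx
      have := fischer_linSubst M.conjTranspose hk hm
      rw [Matrix.conjTranspose_conjTranspose, hi _ (hG M hM)] at this
      rw [fischer_sub_left, this, sub_self]
    | zero => simp [fischer]
    | add x y _ _ hx hy => rw [fischer_add_left, hx, hy, add_zero]
    | smul c x _ hx => rw [fischer_smul_left, hx, mul_zero]
  exact fischer_self_eq_zero (key f hf)

theorem exists_invariant_add_coinvariant (hG : ∀ M ∈ G, M.conjTranspose ∈ G)
    {f : MvPolynomial σ ℂ} {m : ℕ} (hf : f.IsHomogeneous m) :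
    ∃ r ∈ linInvariants G, r.IsHomogeneous m ∧ f - r ∈ coinvariantKernel G m := by
  obtain ⟨w, hw, r, hr, horth, rfl⟩ :=
    exists_add_fischer_orthogonal (coinvariantKernel_le (G := G) m) hf
  refine ⟨r, fun M hM => ?_, hr, by simpa using hw⟩
  have hk : (linSubst M r - r).IsHomogeneous m := (hr.linSubst M).sub hr
  -- With `k = M r - r`, orthogonality of `r` to `M* k - k` says that `M r - r` is orthogonal to
  -- itself.
  have h := horth _ (Submodule.subset_span ⟨_, hG M hM, _, hk, rfl⟩)
  rw [fischer_sub_left, fischer_linSubst M hk hr, ← fischer_sub_right] at h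
  exact sub_eq_zero.mp (fischer_self_eq_zero h)

/-- Coefficients of an invariant in the ideal generated by invariants may be chosen invariant. -/
theorem exists_invariant_coefficients (hG : ∀ M ∈ G, M.conjTranspose ∈ G) {ι : Type*}
    {s : Finset ι} {g : ι → MvPolynomial σ ℂ} {e : ι → ℕ} (hg : ∀ i ∈ s, g i ∈ linInvariants G)
    (he : ∀ i ∈ s, (g i).IsHomogeneous (e i)) {f : MvPolynomial σ ℂ} {m : ℕ}
    (hf : f ∈ linInvariants G) (hm : f.IsHomogeneous m) (hspan : f ∈ Ideal.span (g '' s)) :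
    ∃ h : ι → MvPolynomial σ ℂ, (∀ i, h i ∈ linInvariants G) ∧
      (∀ i, (h i).IsHomogeneous (m - e i)) ∧ (∀ i, m < e i → h i = 0) ∧
      f = ∑ i ∈ s, h i * g i := by
  classical
  obtain ⟨c, hc⟩ := (Submodule.mem_span_image_finset_iff_exists_fun' _).mp hspan
  -- Only the part of `c i` of degree `m - e i` contributes in degree `m`; the case split guards
  -- against truncated subtraction.
  have hcomp : f = ∑ i ∈ s, (if m < e i then 0 else homogeneousComponent (m - e i) (c i)) * g i := by
    conv_lhs => rw [← homogeneousComponent_eq_self hm, ← hc, map_sum]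
    refine Finset.sum_congr rfl fun i hi => ?_
    conv_lhs => rw [← sum_homogeneousComponent (c i), smul_eq_mul, Finset.sum_mul, map_sum]
    have h (k : ℕ) : homogeneousComponent m (homogeneousComponent k (c i) * g i) =
        if m = k + e i then homogeneousComponent k (c i) * g i else 0 :=
      homogeneousComponent_of_mem ((homogeneousComponent_isHomogeneous k (c i)).mul (he i hi))
    simp only [h]
    split_ifs with hlt
    · rw [zero_mul]
      exact Finset.sum_eq_zero fun k _ => if_neg (by omega)
    · rw [Finset.sum_eq_single (m - e i)]
      · rw [if_pos (by omega)]
      · intro k _ hk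
        exact if_neg (by omega)
      · intro hk
        rw [homogeneousComponent_eq_zero _ _ (by simp at hk; omega)]
        simp
  have hdec (i : ι) := exists_invariant_add_coinvariant hG
    (homogeneousComponent_isHomogeneous (m - e i) (c i))
  choose r hr hrm hrw using hdec
  refine ⟨fun i => if m < e i then 0 else r i, fun i => ?_, fun i => ?_, fun i hi => if_pos hi, ?_⟩
  · dsimp only
    split_ifs
    exacts [zero_mem _, hr i]
  · dsimp only
    split_ifs
    exacts [isHomogeneous_zero _ _ _, hrm i]
  -- Replacing coefficients by their invariant parts changes `f` by an element that is both
  -- invariant and in the coinvariant kernel, hence zero.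
  · refine sub_eq_zero.mp (eq_zero_of_mem_coinvariantKernel hG (m := m) ?_ ?_)
    · nth_rewrite 1 [hcomp]
      rw [← Finset.sum_sub_distrib]
      refine sum_mem fun i hi => ?_
      rw [← sub_mul]
      dsimp only
      split_ifs with hlt
      · simp
      · have := mul_mem_coinvariantKernel (hrw i) (hg i hi) (he i hi)
        rwa [Nat.sub_add_cancel (not_lt.mp hlt)] at this
    · refine sub_mem hf (sum_mem fun i hi => mul_mem ?_ (hg i hi))
      dsimp only
      split_ifs
      exacts [zero_mem _, hr i]

end Invariants

/-! ### Hilbert's finiteness argument -/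

section Finiteness

variable {σ : Type} [Fintype σ] {G : Set (Matrix σ σ ℂ)} {ι : Type}
  {f : ι → MvPolynomial σ ℂ}

theorem exists_pow_span_le_of_zeros {s : Set (MvPolynomial σ ℂ)}
    (hzero : ∀ v : σ → ℂ, (∀ i, eval v (f i) = 0) → ∀ g ∈ s, eval v g = 0) :
    ∃ k : ℕ, Ideal.span s ^ k ≤ Ideal.span (Set.range f) := by
  have hle : Ideal.span s ≤ (Ideal.span (Set.range f)).radical := by
    rw [← vanishingIdeal_zeroLocus_eq_radical (K := ℂ), Ideal.span_le]
    intro g hg v hv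
    change eval v g = 0
    refine hzero v (fun i => ?_) g hg
    exact hv (f i) (Ideal.subset_span ⟨i, rfl⟩)
  obtain ⟨k, hk⟩ := (Ideal.span (Set.range f)).exists_radical_pow_le_of_fg
    (IsNoetherian.noetherian _)
  exact ⟨k, (Ideal.pow_right_mono hle k).trans hk⟩

/-- Invariants of large degree lie in the ideal generated by invariants that cut out the
nullcone. -/
theorem exists_degree_bound_mem_span (hG : ∀ M ∈ G, M.conjTranspose ∈ G)
    (hzero : ∀ v : σ → ℂ, (∀ i, eval v (f i) = 0) → v ∈ nullcone (linInvariants G)) :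
    ∃ D : ℕ, ∀ m, D ≤ m → ∀ h ∈ linInvariants G, h.IsHomogeneous m →
      h ∈ Ideal.span (Set.range f) := by
  classical
  set s : Set (MvPolynomial σ ℂ) :=
    {h | h ∈ linInvariants G ∧ ∃ m : ℕ, 0 < m ∧ h.IsHomogeneous m}
  obtain ⟨k, hk⟩ := exists_pow_span_le_of_zeros (f := f) (s := s)
    fun v hv g ⟨hg, m, hm, hgm⟩ => hzero v hv g hg m hm hgm
  obtain ⟨t, hts, ht⟩ := (Submodule.fg_span_iff_fg_span_finset_subset s).mp
    (IsNoetherian.noetherian (Ideal.span s))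
  choose! e he0 he using fun h (hh : h ∈ s) => hh.2
  -- `N` exceeds the degree of every generator in `t`, so splitting off one generator costs less
  -- than `N` in degree.
  set N : ℕ := 1 + ∑ g ∈ t, e g
  have hpow : ∀ j m : ℕ, j * N ≤ m → ∀ h ∈ linInvariants G, h.IsHomogeneous m →
      h ∈ Ideal.span s ^ j := by
    intro j
    induction j with
    | zero => simp
    | succ j ih =>
      intro m hm h hh hhm
      have hmN : j * N + N ≤ m := by rwa [← Nat.succ_mul]
      have hmem : h ∈ Ideal.span (id '' (t : Set (MvPolynomial σ ℂ))) := by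
        rw [Set.image_id]
        change h ∈ Submodule.span _ _
        rw [← ht]
        exact Ideal.subset_span ⟨hh, m, by omega, hhm⟩
      obtain ⟨c, hc, hcm, -, rfl⟩ := exists_invariant_coefficients hG (e := e)
        (fun g hg => (hts hg).1) (fun g hg => he g (hts hg)) hh hhm hmem
      rw [pow_succ]
      refine sum_mem fun g hg => Ideal.mul_mem_mul ?_ (Ideal.subset_span (hts hg))
      have := Finset.single_le_sum (f := e) (fun _ _ => Nat.zero_le _) hg
      exact ih (m - e g) (by omega) _ (hc g) (hcm g)
  exact ⟨k * N, fun m hm h hh hhm => hk (hpow k m hm h hh hhm)⟩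

/-- If invariants `f i` of positive degree cut out the nullcone, then the algebra of invariants is
a finite module over the subalgebra that they generate. -/
theorem finite_linInvariants [Fintype ι] (hG : ∀ M ∈ G, M.conjTranspose ∈ G)
    (hmem : ∀ i, f i ∈ linInvariants G) (hhom : ∀ i, ∃ m : ℕ, 0 < m ∧ (f i).IsHomogeneous m)
    (hzero : ∀ v : σ → ℂ, (∀ i, eval v (f i) = 0) → v ∈ nullcone (linInvariants G)) :
    Module.Finite (Algebra.adjoin ℂ (Set.range fun i => (⟨f i, hmem i⟩ : linInvariants G)))
      (linInvariants G) := by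
  classical
  obtain ⟨D, hD⟩ := exists_degree_bound_mem_span hG hzero
  choose e he0 he using hhom
  set A := Algebra.adjoin ℂ (Set.range fun i => (⟨f i, hmem i⟩ : linInvariants G))
  -- The invariants of degree at most `D` will generate the module; those of higher degree reduce to
  -- them by strong induction.
  let U : Submodule ℂ (linInvariants G) :=
    (restrictTotalDegree σ ℂ D).comap (linInvariants G).val.toLinearMap
  have hU : U.FG := by
    have : Module.Finite ℂ U := Module.Finite.of_injective
      ((linInvariants G).val.toLinearMap.restrict (p := U) (q := restrictTotalDegree σ ℂ D)
        fun x hx => hx) fun x y hxy => by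
          apply Subtype.ext
          apply Subtype.ext
          exact congrArg (fun z : restrictTotalDegree σ ℂ D => z.1) hxy
    exact Module.Finite.iff_fg.mp this
  obtain ⟨t, ht⟩ := hU
  refine ⟨⟨t, eq_top_iff.mpr ?_⟩⟩
  have hUt : ∀ x ∈ U, x ∈ Submodule.span A (t : Set (linInvariants G)) := fun x hx =>
    Submodule.span_le_restrictScalars ℂ A _ (ht ▸ hx)
  have hhomog : ∀ m : ℕ, ∀ h : linInvariants G, h.1.IsHomogeneous m →
      h ∈ Submodule.span A (t : Set (linInvariants G)) := by
    intro m
    induction m using Nat.strong_induction_on with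
    | _ m ih =>
      intro h hm
      rcases lt_or_ge m D with hlt | hge
      · refine hUt h ?_
        rw [Submodule.mem_comap, mem_restrictTotalDegree]
        exact hm.totalDegree_le.trans hlt.le
      · obtain ⟨c, hc, hcm, hc0, hsum⟩ := exists_invariant_coefficients hG (s := Finset.univ)
          (g := f) (e := e) (fun i _ => hmem i) (fun i _ => he i) h.2 hm
          (by simpa using hD m hge h h.2 hm)
        have hsum' : h = ∑ i, (⟨⟨f i, hmem i⟩, Algebra.subset_adjoin ⟨i, rfl⟩⟩ : A) •
            (⟨c i, hc i⟩ : linInvariants G) := by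
          apply Subtype.ext
          rw [hsum, AddSubmonoidClass.coe_finsetSum]
          exact Finset.sum_congr rfl fun i _ => mul_comm _ _
        rw [hsum']
        refine sum_mem fun i _ => Submodule.smul_mem _ _ ?_
        rcases lt_or_ge m (e i) with hlt | hle
        · have : (⟨c i, hc i⟩ : linInvariants G) = 0 := Subtype.ext (hc0 i hlt)
          rw [this]
          exact zero_mem _
        · exact ih (m - e i) (by have := he0 i; omega) _ (hcm i)
  intro h _
  have hsum : h = ∑ i ∈ Finset.range (h.1.totalDegree + 1),
      (⟨homogeneousComponent i h.1, homogeneousComponent_mem_linInvariants h.2 i⟩ :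
        linInvariants G) := by
    apply Subtype.ext
    rw [AddSubmonoidClass.coe_finsetSum]
    exact (sum_homogeneousComponent h.1).symm
  rw [hsum]
  exact sum_mem fun i _ => hhomog i _ (homogeneousComponent_isHomogeneous i h.1)

end Finiteness

/-! ### The orthogonal group and its nullcone -/

section Orthogonal

open scoped Kronecker

variable {n d : ℕ}

theorem momentumSubst_eq_linSubst (A : Matrix (Fin d) (Fin d) ℂ) :
    momentumSubst (n := n) A = linSubst ((1 : Matrix (Fin n) (Fin n) ℂ) ⊗ₖ A) := by
  ext1 x
  simp only [momentumSubst, linSubst, aeval_X, Fintype.sum_prod_type,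
    Matrix.kroneckerMap_apply, Matrix.one_apply]
  rw [Finset.sum_eq_single x.1]
  · simp
  · intro j _ hj
    simp [hj.symm]
  · simp

theorem orthogonalInvariants_eq_linInvariants :
    orthogonalInvariants n d = linInvariants
      ((fun A => (1 : Matrix (Fin n) (Fin n) ℂ) ⊗ₖ A) '' Matrix.orthogonalGroup (Fin d) ℂ) := by
  ext f
  refine Iff.trans ?_ Set.forall_mem_image.symm
  simp only [← momentumSubst_eq_linSubst]
  rfl

theorem conjTranspose_mem_image_orthogonalGroup (M : Matrix (Fin n × Fin d) (Fin n × Fin d) ℂ)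
    (hM : M ∈ (fun A => (1 : Matrix (Fin n) (Fin n) ℂ) ⊗ₖ A) ''
      Matrix.orthogonalGroup (Fin d) ℂ) :
    M.conjTranspose ∈ (fun A => (1 : Matrix (Fin n) (Fin n) ℂ) ⊗ₖ A) ''
      Matrix.orthogonalGroup (Fin d) ℂ := by
  obtain ⟨A, hA, rfl⟩ := hM
  refine ⟨A.conjTranspose, ?_, by simp [Matrix.conjTranspose_kronecker]⟩
  rw [SetLike.mem_coe, Matrix.mem_orthogonalGroup_iff'] at hA
  rw [SetLike.mem_coe, Matrix.mem_orthogonalGroup_iff]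
  have := congrArg Matrix.conjTranspose hA
  rwa [Matrix.conjTranspose_mul, Matrix.conjTranspose_one] at this

theorem eval_momentumSubst (A : Matrix (Fin d) (Fin d) ℂ) (f : MomentumPoly n d)
    (v : Fin n × Fin d → ℂ) :
    eval v (momentumSubst A f) = eval (fun x => A.mulVec (fun k => v (x.1, k)) x.2) f := by
  rw [momentumSubst_eq_linSubst, eval_linSubst]
  congr 2
  ext x
  simp only [Matrix.mulVec, dotProduct, Fintype.sum_prod_type, Matrix.kroneckerMap_apply,
    Matrix.one_apply]
  rw [Finset.sum_eq_single x.1]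
  · simp
  · intro j _ hj
    simp [hj.symm]
  · simp

theorem eval_dotPoly (i j : Fin n) (v : Fin n × Fin d → ℂ) :
    eval v (dotPoly i j) = (fun k => v (i, k)) ⬝ᵥ fun k => v (j, k) := by
  simp [dotPoly, dotProduct]

theorem isHomogeneous_dotPoly (i j : Fin n) : (dotPoly i j : MomentumPoly n d).IsHomogeneous 2 :=
  IsHomogeneous.sum _ _ _ fun _ _ => (isHomogeneous_X _ _).mul (isHomogeneous_X _ _)

theorem dotPoly_mem_orthogonalInvariants (i j : Fin n) :
    dotPoly i j ∈ orthogonalInvariants n d := by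
  intro A hA
  refine MvPolynomial.funext fun v => ?_
  rw [Matrix.mem_orthogonalGroup_iff'] at hA
  rw [eval_momentumSubst, eval_dotPoly, eval_dotPoly]
  change A.mulVec (fun k => v (i, k)) ⬝ᵥ A.mulVec (fun k => v (j, k)) = _
  rw [Matrix.dotProduct_mulVec, Matrix.vecMul_mulVec]
  erw [hA]
  simp

theorem dotPoly_comm (i j : Fin n) : (dotPoly i j : MomentumPoly n d) = dotPoly j i :=
  Finset.sum_congr rfl fun _ _ => mul_comm _ _

/-- An orthogonal matrix acting as multiplication by `2` on a totally isotropic family. -/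
theorem exists_orthogonal_mulVec_eq_two_smul {ι : Type} (p : ι → Fin d → ℂ)
    (hp : ∀ i j, p i ⬝ᵥ p j = 0) :
    ∃ A ∈ Matrix.orthogonalGroup (Fin d) ℂ, ∀ i, A.mulVec (p i) = (2 : ℂ) • p i := by
  set L : Submodule ℂ (EuclideanSpace ℂ (Fin d)) :=
    Submodule.span ℂ (Set.range fun i => WithLp.toLp 2 (p i))
  have hL : ∀ x ∈ L, ∀ y ∈ L, x.ofLp ⬝ᵥ y.ofLp = 0 := by
    intro x hx y hy
    induction hx, hy using Submodule.span_induction₂ with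
    | mem_mem x y hx hy =>
      obtain ⟨i, rfl⟩ := hx
      obtain ⟨j, rfl⟩ := hy
      exact hp i j
    | zero_left y _ => simp
    | zero_right x _ => simp
    | add_left x y z _ _ _ hx hy => simp [add_dotProduct, hx, hy]
    | add_right x y z _ _ _ hx hy => simp [dotProduct_add, hx, hy]
    | smul_left r x y _ _ hx => simp [hx]
    | smul_right r x y _ _ hx => simp [hx]
  -- `P` is the Hermitian projection onto `L`, so its transpose projects onto the complex conjugate
  -- of `L`. Isotropy makes the two projections annihilate each other.
  set P : Matrix (Fin d) (Fin d) ℂ :=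
    Matrix.toEuclideanLin.symm (L.starProjection : EuclideanSpace ℂ (Fin d) →ₗ[ℂ] _)
  have hPlin : Matrix.toEuclideanLin P = L.starProjection.toLinearMap := by simp [P]
  have hP (x : Fin d → ℂ) : P.mulVec x = (L.starProjection (WithLp.toLp 2 x)).ofLp := by
    have := LinearMap.congr_fun hPlin (WithLp.toLp 2 x)
    rw [Matrix.toLpLin_toLp] at this
    exact congrArg WithLp.ofLp this
  have hidem : P * P = P := by
    refine Matrix.ext_of_mulVec_single fun i => ?_
    rw [← Matrix.mulVec_mulVec, hP, hP, WithLp.toLp_ofLp,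
      L.starProjection_eq_self_iff.mpr (L.starProjection_apply_mem _)]
  have hherm : P.conjTranspose = P := by
    have : P.IsHermitian := by
      rw [← Matrix.isSymmetric_toEuclideanLin_iff, hPlin]
      exact L.starProjection_isSymmetric
    exact this
  have hiso : P.transpose * P = 0 := by
    ext i j
    have := hL _ (L.starProjection_apply_mem (WithLp.toLp 2 (Pi.single i 1))) _
      (L.starProjection_apply_mem (WithLp.toLp 2 (Pi.single j 1)))
    rw [← hP, ← hP] at this
    simpa [Matrix.mul_apply, dotProduct] using this
  have hiso' : P * P.transpose = 0 := by
    have h := congrArg Matrix.conjTranspose hiso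
    have ht : P.transpose.conjTranspose = P.transpose := by
      conv_rhs => rw [← hherm]
      rfl
    rwa [Matrix.conjTranspose_mul, ht, hherm, Matrix.conjTranspose_zero] at h
  have hidem' : P.transpose * P.transpose = P.transpose := by
    rw [← Matrix.transpose_mul, hidem]
  -- This matrix scales `L` by 2, its conjugate by 1/2, and fixes the orthogonal complement of both;
  -- its transpose swaps the two factors and is therefore its inverse.
  refine ⟨1 + P - (2⁻¹ : ℂ) • P.transpose, ?_, fun i => ?_⟩
  · rw [Matrix.mem_orthogonalGroup_iff]
    rw [Matrix.transpose_sub, Matrix.transpose_add, Matrix.transpose_one, Matrix.transpose_smul,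
      Matrix.transpose_transpose]
    simp only [add_mul, sub_mul, mul_add, mul_sub, one_mul, mul_one, smul_mul_assoc,
      mul_smul_comm, hidem, hidem', hiso, hiso', smul_zero]
    module
  · have hi : P.mulVec (p i) = p i := by
      rw [hP, L.starProjection_eq_self_iff.mpr (Submodule.subset_span ⟨i, rfl⟩)]
    have hi' : P.transpose.mulVec (p i) = 0 := by
      rw [← hi, Matrix.mulVec_mulVec, hiso, Matrix.zero_mulVec]
    rw [Matrix.sub_mulVec, Matrix.add_mulVec, Matrix.smul_mulVec, hi, hi', Matrix.one_mulVec]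
    module

theorem MvPolynomial.IsHomogeneous.eval_smul {σ : Type} {f : MvPolynomial σ ℂ} {m : ℕ}
    (hf : f.IsHomogeneous m) (c : ℂ) (v : σ → ℂ) : eval (c • v) f = c ^ m * eval v f := by
  rw [eval_eq, eval_eq, Finset.mul_sum]
  refine Finset.sum_congr rfl fun a ha => ?_
  have h : ∑ i ∈ a.support, a i = m := (hf.degree_eq_sum_deg_support ha).symm
  simp only [Pi.smul_apply, smul_eq_mul, mul_pow]
  rw [Finset.prod_mul_distrib, Finset.prod_pow_eq_pow_sum, h]
  ring

theorem nullcone_orthogonalInvariants :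
    nullcone (orthogonalInvariants n d) = {v | ∀ i j : Fin n, eval v (dotPoly i j) = 0} := by
  refine Set.Subset.antisymm (fun v hv i j => hv _ (dotPoly_mem_orthogonalInvariants i j) 2
    two_pos (isHomogeneous_dotPoly i j)) fun v hv f hf m hm hfm => ?_
  obtain ⟨A, hA, hAp⟩ := exists_orthogonal_mulVec_eq_two_smul (fun i k => v (i, k))
    fun i j => by rw [← eval_dotPoly, hv i j]
  have h := congrArg (eval v) (hf A hA)
  have h2 : (fun x : Fin n × Fin d => A.mulVec (fun k => v (x.1, k)) x.2) = (2 : ℂ) • v := by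
    ext x
    rw [hAp x.1]
    rfl
  rw [eval_momentumSubst, h2, hfm.eval_smul] at h
  have h3 : ((2 : ℂ) ^ m - 1) * eval v f = 0 := by rw [sub_mul, h, one_mul, sub_self]
  refine (mul_eq_zero.mp h3).resolve_left fun h4 => ?_
  have h5 : (2 : ℕ) ^ m = 1 := by exact_mod_cast sub_eq_zero.mp h4
  exact hm.ne' (by simpa using h5)

end Orthogonal

/-! ### The Jacobian criterion -/

section Jacobian

variable {σ τ : Type}

theorem pderiv_aeval [Fintype τ] (f : τ → MvPolynomial σ ℂ) (P : MvPolynomial τ ℂ) (t : σ) :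
    pderiv t (aeval f P) = ∑ s, aeval f (pderiv s P) * pderiv t (f s) := by
  classical
  induction P using MvPolynomial.induction_on with
  | C a => simp
  | add p q hp hq => simp only [map_add, hp, hq, add_mul, Finset.sum_add_distrib]
  | mul_X p i hp =>
    have h : ∀ s, aeval f (pderiv s (p * X i)) * pderiv t (f s) =
        aeval f (pderiv s p) * pderiv t (f s) * f i +
          if s = i then aeval f p * pderiv t (f s) else 0 := by
      intro s
      rw [pderiv_mul, map_add, map_mul, map_mul, aeval_X, pderiv_X]
      rcases eq_or_ne s i with rfl | hs
      · rw [Pi.single_eq_same, map_one, if_pos rfl]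
        ring
      · rw [Pi.single_eq_of_ne' hs, map_zero, if_neg hs]
        ring
    rw [map_mul, aeval_X, pderiv_mul, hp, Finset.sum_congr rfl fun s _ => h s,
      Finset.sum_add_distrib, Finset.sum_ite_eq' Finset.univ i, if_pos (Finset.mem_univ i),
      Finset.sum_mul]

theorem totalDegree_pderiv_le (P : MvPolynomial τ ℂ) (s : τ) :
    (pderiv s P).totalDegree ≤ P.totalDegree - 1 := by
  classical
  refine Finset.sup_le fun m hm => ?_
  rw [mem_support_iff, coeff_pderiv] at hm
  have h := le_totalDegree (mem_support_iff.mpr (left_ne_zero_of_mul hm))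
  rw [Finsupp.sum_add_index' (by simp) (by simp), Finsupp.sum_single_index rfl] at h
  exact Nat.le_sub_of_add_le h

theorem eq_C_of_pderiv_eq_zero {P : MvPolynomial τ ℂ} (h : ∀ s, pderiv s P = 0) :
    P = C (coeff 0 P) := by
  classical
  ext m
  rw [coeff_C]
  split_ifs with hm
  · rw [hm]
  · obtain ⟨s, hs⟩ := Finsupp.ne_iff.mp (Ne.symm hm)
    have h1 := coeff_pderiv (i := s) P (m - Finsupp.single s 1)
    have hle : Finsupp.single s 1 ≤ m := by
      rw [Finsupp.single_le_iff]
      exact Nat.one_le_iff_ne_zero.mpr (by simpa using hs)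
    rw [h s, coeff_zero, tsub_add_cancel_of_le hle] at h1
    rcases mul_eq_zero.mp h1.symm with h2 | h2
    · exact h2
    · exact absurd h2 (Nat.cast_add_one_ne_zero _)

/-- The Jacobian criterion for algebraic independence. -/
theorem algebraicIndependent_of_det_ne_zero [Fintype τ] [DecidableEq τ]
    (f : τ → MvPolynomial σ ℂ) (t : τ → σ) (v : σ → ℂ)
    (hdet : (Matrix.of fun i j => eval v (pderiv (t j) (f i))).det ≠ 0) :
    AlgebraicIndependent ℂ f := by
  have hJ : (Matrix.of fun i j => pderiv (t j) (f i)).det ≠ 0 := by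
    intro h
    apply hdet
    have := congrArg (eval v) h
    rwa [RingHom.map_det, map_zero] at this
  rw [algebraicIndependent_iff]
  suffices h : ∀ n : ℕ, ∀ P : MvPolynomial τ ℂ, P.totalDegree ≤ n → aeval f P = 0 → P = 0 from
    fun P => h _ P le_rfl
  intro n
  induction n with
  | zero =>
    intro P hP h0
    rw [totalDegree_eq_zero_iff_eq_C.mp (Nat.le_zero.mp hP)] at h0 ⊢
    simpa using h0
  | succ n ih =>
    intro P hP h0
    have hd : ∀ s, pderiv s P = 0 := by
      -- Differentiating the relation `P(f) = 0` by the chain rule puts the vector of `(∂P/∂s)(f)`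
      -- in the left kernel of the Jacobian. The partial derivatives of `P` are thus relations of
      -- smaller degree.
      have hv : Matrix.vecMul (fun s => aeval f (pderiv s P))
          (Matrix.of fun i j => pderiv (t j) (f i)) = 0 := by
        ext1 j
        have := pderiv_aeval f P (t j)
        rw [h0, map_zero] at this
        exact this.symm
      have hz := Matrix.eq_zero_of_vecMul_eq_zero hJ hv
      intro s
      refine ih _ ?_ (congrFun hz s)
      have := totalDegree_pderiv_le P s
      omega
    rw [eq_C_of_pderiv_eq_zero hd] at h0 ⊢
    simpa using h0

end Jacobian

/-! ### The parameters `θ` and `α` -/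

section Params

theorem det_dotPoly_eq_zero (d : ℕ) :
    (Matrix.of fun i j : Fin (d + 1) => (dotPoly i j : MomentumPoly (d + 1) d)).det = 0 := by
  -- A zero column pads the matrix of momenta to a square one without changing its Gram matrix.
  set M : Matrix (Fin (d + 1)) (Fin (d + 1)) (MomentumPoly (d + 1) d) :=
    Matrix.of fun i k => Fin.cases 0 (fun l => X (i, l)) k
  have h : (Matrix.of fun i j : Fin (d + 1) => (dotPoly i j : MomentumPoly (d + 1) d)) =
      M * M.transpose := by
    ext1 i j
    simp [Matrix.mul_apply, Fin.sum_univ_succ, M, dotPoly]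
  rw [h, Matrix.det_mul, Matrix.det_eq_zero_of_column_eq_zero (A := M) 0 fun i => rfl, zero_mul]

theorem eval_dotPoly_eq_zero_of_params {d : ℕ} {v : Fin (d + 1) × Fin d → ℂ}
    (hv : ∀ s, eval v (params d s) = 0) (i j : Fin (d + 1)) : eval v (dotPoly i j) = 0 := by
  have hlt (i j : Fin (d + 1)) (hij : i < j) : eval v (dotPoly i j) = 0 := hv (.inr ⟨(i, j), hij⟩)
  have hne (i j : Fin (d + 1)) (hij : i ≠ j) : eval v (dotPoly i j) = 0 := by
    rcases hij.lt_or_gt with h | h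
    · exact hlt i j h
    · rw [dotPoly_comm]
      exact hlt j i h
  have hadd (i : Fin d) : eval v (dotPoly 0 0) + eval v (dotPoly i.succ i.succ) = 0 := by
    simpa [params] using hv (.inl i)
  have hprod : ∏ i : Fin (d + 1), eval v (dotPoly i i) = 0 := by
    have h := congrArg (eval v) (det_dotPoly_eq_zero d)
    rw [RingHom.map_det, map_zero] at h
    rw [← h, ← Matrix.det_diagonal]
    congr 1
    ext i j
    rcases eq_or_ne i j with rfl | hij
    · simp
    · simp [hij, hne i j hij]
  have h0 : eval v (dotPoly 0 0) = 0 := by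
    obtain ⟨i, -, hi⟩ := Finset.prod_eq_zero_iff.mp hprod
    cases i using Fin.cases with
    | zero => exact hi
    | succ i => simpa [hi] using hadd i
  rcases eq_or_ne i j with rfl | hij
  · cases i using Fin.cases with
    | zero => exact h0
    | succ i => simpa [h0] using hadd i
  · exact hne i j hij

theorem params_mem (d : ℕ) (s : ParamIndex d) : params d s ∈ orthogonalInvariants (d + 1) d := by
  rcases s with i | x
  · exact add_mem (dotPoly_mem_orthogonalInvariants _ _) (dotPoly_mem_orthogonalInvariants _ _)
  · exact dotPoly_mem_orthogonalInvariants _ _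

theorem isHomogeneous_params (d : ℕ) (s : ParamIndex d) : (params d s).IsHomogeneous 2 := by
  rcases s with i | x
  · exact (isHomogeneous_dotPoly _ _).add (isHomogeneous_dotPoly _ _)
  · exact isHomogeneous_dotPoly _ _

/-- The coordinate `p_{i+1}^i` for `θ_i` and `p_i^{j-1}` for `α_{ij}`. -/
def paramCoord (d : ℕ) : ParamIndex d → MinorCoord d
  | Sum.inl i => ⟨(i.succ, i), le_rfl⟩
  | Sum.inr x => ⟨(x.1.1, x.1.2.pred (Fin.ne_zero_of_lt x.2)), by
      rw [Fin.succ_pred]; exact x.2.le⟩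

theorem paramCoord_bijective (d : ℕ) : Function.Bijective (paramCoord d) := by
  constructor
  · rintro (i | ⟨⟨a, b⟩, hab⟩) (j | ⟨⟨a', b'⟩, hab'⟩) h
    · have : i = j := congrArg (fun x => x.1.2) h
      rw [this]
    · obtain ⟨h1, h2⟩ := Prod.ext_iff.mp (congrArg Subtype.val h)
      simp only [paramCoord] at h1 h2
      rw [← h1, h2, Fin.succ_pred] at hab'
      exact absurd hab' (lt_irrefl _)
    · obtain ⟨h1, h2⟩ := Prod.ext_iff.mp (congrArg Subtype.val h)
      simp only [paramCoord] at h1 h2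
      rw [h1, ← h2, Fin.succ_pred] at hab
      exact absurd hab (lt_irrefl _)
    · obtain ⟨h1, h2⟩ := Prod.ext_iff.mp (congrArg Subtype.val h)
      simp only [paramCoord, Fin.pred_inj] at h1 h2
      subst h1 h2
      rfl
  · rintro ⟨⟨a, k⟩, hak⟩
    rcases eq_or_lt_of_le hak with h | h
    · refine ⟨.inl k, Subtype.ext (Prod.ext h.symm rfl)⟩
    · refine ⟨.inr ⟨(a, k.succ), h⟩, Subtype.ext (Prod.ext rfl ?_)⟩
      simp [paramCoord]

/-- The enumeration of the coordinates of the minor by the parameters. -/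
noncomputable def paramCoordEquiv (d : ℕ) : ParamIndex d ≃ MinorCoord d :=
  Equiv.ofBijective (paramCoord d) (paramCoord_bijective d)

theorem eval_basePoint_pderiv_dotPoly {d : ℕ} (i j a : Fin (d + 1)) (k : Fin d) :
    eval (basePoint d) (pderiv (a, k) (dotPoly i j : MomentumPoly (d + 1) d)) =
      (if a = i ∧ j = k.succ then 1 else 0) + if a = j ∧ i = k.succ then 1 else 0 := by
  have h (l : Fin d) : eval (basePoint d) (pderiv (a, k) (X (i, l) * X (j, l) :
      MomentumPoly (d + 1) d)) = if l = k then
        (if a = i ∧ j = k.succ then 1 else 0) + (if a = j ∧ i = k.succ then 1 else 0) else 0 := by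
    rw [pderiv_mul, pderiv_X, pderiv_X]
    rcases eq_or_ne l k with rfl | hl
    · have hX (b : Fin (d + 1)) : eval (basePoint d) (Pi.single (M := fun _ => MomentumPoly (d + 1) d)
          (a, l) 1 (b, l)) = if a = b then 1 else 0 := by
        rw [Pi.single_apply]
        simp [apply_ite (eval (basePoint d)), eq_comm]
      simp only [map_add, map_mul, eval_X, hX, basePoint, if_true, mul_ite, mul_one, mul_zero,
        ← ite_and, and_comm (a := j = l.succ)]
    · simp [hl]
  simp only [dotPoly, map_sum, h, Finset.sum_ite_eq', Finset.mem_univ, if_true]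

/-- At the base point, `p_i · p_j` has nonzero derivative along `p_a^k` only if `{i, j} = {a, k+1}`,
so each selected coordinate meets one parameter. The entry is 2 when `i = j`, as both factors
contribute, and 1 otherwise; `p_0 · p_0` contributes nothing. -/
theorem jacobian_params (d : ℕ) :
    (Matrix.of fun s t : ParamIndex d =>
      eval (basePoint d) (pderiv (paramCoordEquiv d t).1 (params d s))) =
      Matrix.diagonal (Sum.elim (fun _ => 2) fun _ => 1) := by
  ext s t
  have hcoord : (paramCoordEquiv d t).1 = (paramCoord d t).1 := rfl
  rw [Matrix.of_apply, hcoord]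
  rcases s with i | ⟨⟨i, j⟩, hij⟩ <;> rcases t with k | ⟨⟨a, b⟩, hab⟩ <;>
    simp only [params, paramCoord, map_add, eval_basePoint_pderiv_dotPoly, Fin.succ_pred]
  · rcases eq_or_ne i k with rfl | h
    · norm_num
    · simp [h, h.symm]
  · have h0 : (0 : Fin (d + 1)) ≠ b := (Fin.ne_zero_of_lt hab).symm
    have h1 : ¬(a = i.succ ∧ i.succ = b) := fun h => hab.ne (h.1.trans h.2)
    simp [h0, h1]
  · have h1 : ¬(k.succ = i ∧ j = k.succ) := fun h => hij.ne (h.1.symm.trans h.2.symm)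
    have h2 : ¬(k.succ = j ∧ i = k.succ) := fun h => hij.ne (h.2.trans h.1)
    simp [h1, h2]
  · have h2 : ¬(a = j ∧ i = b) := fun h => (hab.trans (h.2 ▸ hij)).ne h.1
    rw [if_neg h2, add_zero]
    simp [Matrix.diagonal_apply, eq_comm (a := a)]

theorem det_jacobian_params (d : ℕ) :
    (Matrix.of fun s t : ParamIndex d =>
      eval (basePoint d) (pderiv (paramCoordEquiv d t).1 (params d s))).det = 2 ^ d := by
  rw [jacobian_params, Matrix.det_diagonal, Fintype.prod_sum_type]
  simp

theorem algebraicIndependent_params (d : ℕ) : AlgebraicIndependent ℂ (params d) :=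
  algebraicIndependent_of_det_ne_zero _ (fun t => (paramCoordEquiv d t).1) (basePoint d) <| by
    rw [det_jacobian_params]
    exact pow_ne_zero _ two_ne_zero

theorem card_paramIndex (d : ℕ) : Nat.card (ParamIndex d) = d * (d + 3) / 2 := by
  have h : Fintype.card {x : Fin (d + 1) × Fin (d + 1) // x.1 < x.2} = (d + 1) * d / 2 := by
    rw [Fintype.card_subtype, Finset.card_filter, Fintype.sum_prod_type_right]
    simp only [← Finset.card_filter]
    have h (j : Fin (d + 1)) : (Finset.univ.filter fun i => i < j).card = j.1 := by
      rw [← Fin.card_Iio j]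
      congr 1
      ext i
      simp
    rw [Finset.sum_congr rfl fun j _ => h j, Fin.sum_univ_eq_sum_range (fun i => i),
      Finset.sum_range_id, Nat.add_sub_cancel]
  rw [Nat.card_eq_fintype_card, Fintype.card_sum, Fintype.card_fin, h,
    show d * (d + 3) = (d + 1) * d + d * 2 by ring, Nat.add_mul_div_right _ _ two_pos, add_comm]

theorem isHSOP_params (d : ℕ) : IsHSOP (orthogonalInvariants (d + 1) d) (params d) where
  mem := params_mem d
  homogeneous s := ⟨2, two_pos, isHomogeneous_params d s⟩
  algebraicIndependent := algebraicIndependent_params d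
  finite := by
    have hnull : ∀ v, (∀ s, eval v (params d s) = 0) →
        v ∈ nullcone (orthogonalInvariants (d + 1) d) := fun v hv => by
      rw [nullcone_orthogonalInvariants]
      exact eval_dotPoly_eq_zero_of_params hv
    -- Membership proofs occur inside the types, so the subalgebra is generalized before it is
    -- rewritten.
    have key : ∀ S : Subalgebra ℂ (MomentumPoly (d + 1) d),
        S = orthogonalInvariants (d + 1) d → ∀ hS : ∀ s, params d s ∈ S,
        Module.Finite (Algebra.adjoin ℂ (Set.range fun s => (⟨params d s, hS s⟩ : S))) S := by
      rintro S rfl hS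
      revert hS hnull
      rw [orthogonalInvariants_eq_linInvariants]
      exact fun hnull hS => finite_linInvariants conjTranspose_mem_image_orthogonalGroup hS
        (fun s => ⟨2, two_pos, isHomogeneous_params d s⟩) hnull
    exact key _ rfl _

end Params

theorem mainTheorem1 (d : ℕ) :
    IsHSOP (orthogonalInvariants (d + 1) d) (params d) ∧
    (Set.range (params d)).ncard = d * (d + 3) / 2 ∧
    {v | ∀ s, eval v (params d s) = 0} = nullcone (orthogonalInvariants (d + 1) d) ∧
    nullcone (orthogonalInvariants (d + 1) d) =
      {v | ∀ i j : Fin (d + 1), eval v (dotPoly i j) = 0} ∧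
    (Matrix.of fun i j : Fin (d + 1) => (dotPoly i j : MomentumPoly (d + 1) d)).det = 0 ∧
    ∃ e : ParamIndex d ≃ MinorCoord d,
      (Matrix.of fun s t : ParamIndex d =>
        eval (basePoint d) (pderiv (e t).1 (params d s))).det = 2 ^ d := by
  refine ⟨isHSOP_params d, ?_, ?_, nullcone_orthogonalInvariants, det_dotPoly_eq_zero d,
    paramCoordEquiv d, det_jacobian_params d⟩
  · rw [← Nat.card_coe_set_eq,
      Nat.card_range_of_injective (algebraicIndependent_params d).injective, card_paramIndex]
  · refine Set.Subset.antisymm (fun v hv => ?_) fun v hv s =>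
      hv _ (params_mem d s) 2 two_pos (isHomogeneous_params d s)
    rw [nullcone_orthogonalInvariants]
    exact eval_dotPoly_eq_zero_of_params hv
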